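/- **Lemma (Expected sample size, SPRT with switching sensors).** There are $n$ sensors and two hypotheses $H_0,H_1$ with prior probabilities $\pi_0,\pi_1>0$, $\pi_0+\pi_1=1$. For $k\in\{0,1\}$ and $s\in\{1,\dots,n\}$ let $f_s^k$ be a probability density with respect to a common reference measure $\nu$ on the observation space (for instance Lebesgue measure on $\mathbb R$, or counting measure), and let $q_1,\dots,q_n\ge 0$ with $\sum_{s=1}^n q_s=1$. Conditionally on $H_k$, the pairs $(s_l,y_l)$, $l=1,2,\dots$, are independent and identically distributed: sensor $s_l=s$ is chosen with probability $q_s$, and given $s_l=s$ the measurement $y_l$ has density $f_s^k$. Write $\mathcal D(f,g)=\int f\log\frac fg\,d\nu$ for the Kullback–Leibler distance. Assume that $\mathcal D(f_s^0,f_s^1)$ and $\mathcal D(f_s^1,f_s^0)$ are finite for every $s$, and that $f_s^0\neq f_s^1$ (on a set of positive $\nu$-measure) for at least one $s$ with $q_s>0$. For $\alpha_0,\alpha_1\in(0,1)$ (the desired probabilities of false alarm and of missed detection) put $$\eta_0=\log\frac{\alpha_1}{1-\alpha_0},\qquad \eta_1=\log\frac{1-\alpha_1}{\alpha_0},\qquad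 \lambda_0=\log\frac{\pi_1}{\pi_0},\qquad \lambda_l=\log\frac{f_{s_l}^1(y_l)}{f_{s_l}^0(y_l)}\ (l\ge1),\qquad \Lambda_N=\sum_{l=0}^N\lambda_l .$$ The SPRT with switching sensors stops at the first $N\ge1$ at which $\Lambda_N>\eta_1$ (say $H_1$) or $\Lambda_N<\eta_0$ (say $H_0$). Let $N$ also denote this sample size. Then $\mathbb E[N\mid H_0]$ and $\mathbb E[N\mid H_1]$ are finite for all $\alpha_0,\alpha_1\in(0,1)$, and, with $\pi$, $q$ and the densities $f_s^k$ fixed, $$\mathbb E[N\mid H_0]\sim-\frac{(1-\alpha_0)\eta_0+\alpha_0\eta_1-\lambda_0}{\sum_{s=1}^n q_s\,\mathcal D(f_s^0,f_s^1)},\qquad \mathbb E[N\mid H_1]\sim\frac{\alpha_1\eta_0+(1-\alpha_1)\eta_1-\lambda_0}{\sum_{s=1}^n q_s\,\mathcal D(f_s^1,f_s^0)}$$ as $-\eta_0,\eta_1\to\infty$, where $a\sim b$ means that the ratio $a/b$ tends to $1$. -/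

import Mathlib

open MeasureTheory ProbabilityTheory Filter Topology
open scoped ENNReal

namespace SwitchingSPRT

noncomputable section

/-- `f` is a probability density with respect to the reference measure `ν`
(Lebesgue measure for continuous observations, counting measure for discrete ones). -/
structure IsDensity {Y : Type*} [MeasurableSpace Y] (ν : Measure Y) (f : Y → ℝ) : Prop where
  measurable : Measurable f
  nonneg : ∀ y, 0 ≤ f y
  lintegral_eq_one : ∫⁻ y, ENNReal.ofReal (f y) ∂ν = 1

/-- The Kullback-Leibler distance `D(f, g) = ∫ f log (f / g)`. It carries its usual meaning
when it is finite, that is, under `KLFinite`. -/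
def klDist {Y : Type*} [MeasurableSpace Y] (ν : Measure Y) (f g : Y → ℝ) : ℝ :=
  ∫ y, f y * Real.log (f y / g y) ∂ν

/-- `D(f, g)` is a finite real number: `f` vanishes almost everywhere where `g` does (otherwise
`D(f, g) = ∞`), and the integral that defines `D(f, g)` converges. -/
def KLFinite {Y : Type*} [MeasurableSpace Y] (ν : Measure Y) (f g : Y → ℝ) : Prop :=
  (∀ᵐ y ∂ν, g y = 0 → f y = 0) ∧ Integrable (fun y => f y * Real.log (f y / g y)) ν

/-- The probabilistic model. `H` is the true hypothesis, with prior `π`. The `(l+1)`-st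
observation, `l = 0, 1, 2, …`, is made with sensor `s l` and has the value `y l`. Conditionally
on `H = k`, the pairs `(s l, y l)` are independent and identically distributed: sensor `j` is
chosen with probability `q j`, and the value it then yields has density `f k j`. -/
structure IsModel {n : ℕ} {Y : Type*} [MeasurableSpace Y] (ν : Measure Y)
    {Ω : Type*} [MeasurableSpace Ω] (P : Measure Ω)
    (π : Fin 2 → ℝ) (q : Fin n → ℝ) (f : Fin 2 → Fin n → Y → ℝ)
    (H : Ω → Fin 2) (s : ℕ → Ω → Fin n) (y : ℕ → Ω → Y) : Prop where
  measurable_hypothesis : Measurable H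
  measurable_sensor : ∀ l, Measurable (s l)
  measurable_value : ∀ l, Measurable (y l)
  prior : ∀ k, P (H ⁻¹' {k}) = ENNReal.ofReal (π k)
  indep : ∀ k, iIndepFun (fun l ω => (s l ω, y l ω)) (P[|H ⁻¹' {k}])
  law : ∀ k l j (B : Set Y), MeasurableSet B →
    (P[|H ⁻¹' {k}]) (s l ⁻¹' {j} ∩ y l ⁻¹' B)
      = ENNReal.ofReal (q j) * ∫⁻ x in B, ENNReal.ofReal (f k j x) ∂ν

/-- The integrated evidence `Λ_N = λ_0 + λ_1 + ⋯ + λ_N`, where `λ_0 = log (π_1 / π_0)` and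
`λ_l` is the log likelihood ratio of the `l`-th observation. -/
def evidence {n : ℕ} {Y Ω : Type*} (π : Fin 2 → ℝ) (f : Fin 2 → Fin n → Y → ℝ)
    (s : ℕ → Ω → Fin n) (y : ℕ → Ω → Y) (N : ℕ) (ω : Ω) : ℝ :=
  Real.log (π 1 / π 0)
    + ∑ l ∈ Finset.range N, Real.log (f 1 (s l ω) (y l ω) / f 0 (s l ω) (y l ω))

/-- The sample size of the test with thresholds `η₀`, `η₁`: the first `N ≥ 1` at which
`Λ_N > η₁` or `Λ_N < η₀`, and `⊤` if there is none. -/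
def sampleSize {n : ℕ} {Y Ω : Type*} (π : Fin 2 → ℝ) (f : Fin 2 → Fin n → Y → ℝ)
    (s : ℕ → Ω → Fin n) (y : ℕ → Ω → Y) (η₀ η₁ : ℝ) (ω : Ω) : ℕ∞ :=
  ⨅ (N : ℕ) (_ : 1 ≤ N ∧ (η₁ < evidence π f s y N ω ∨ evidence π f s y N ω < η₀)), (N : ℕ∞)

/-- The expectation, possibly infinite, of a random number `N`, conditioned on an event `A`. -/
def condExpSize {Ω : Type*} [MeasurableSpace Ω] (P : Measure Ω) (A : Set Ω)
    (N : Ω → ℕ∞) : ℝ≥0∞ :=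
  ∫⁻ ω, (N ω : ℝ≥0∞) ∂(P[|A])

/-- The lower threshold `η₀ = log (α₁ / (1 - α₀))`, where `α = (α₀, α₁)`. -/
def eta0 (α : ℝ × ℝ) : ℝ := Real.log (α.2 / (1 - α.1))

/-- The upper threshold `η₁ = log ((1 - α₁) / α₀)`, where `α = (α₀, α₁)`. -/
def eta1 (α : ℝ × ℝ) : ℝ := Real.log ((1 - α.2) / α.1)

/-- The admissible desired error probabilities `α = (α₀, α₁)`. -/
def errorPairs : Set (ℝ × ℝ) := Set.Ioo 0 1 ×ˢ Set.Ioo 0 1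

/-- The limit `-η₀, η₁ → ∞` within the admissible pairs `α = (α₀, α₁)`. -/
def largeThresholds : Filter (ℝ × ℝ) :=
  comap (fun α => (-eta0 α, eta1 α)) (atTop ×ˢ atTop) ⊓ 𝓟 errorPairs

end

end SwitchingSPRT

/-!
Under the true hypothesis, the log likelihood ratios in its favour are independent and identically
distributed. Their mean is the average over the sensors of a Kullback-Leibler distance, finite by
assumption and positive by Gibbs' inequality (`klDist_pos`, `IsModel.walk_logRatio`). The sample
size is thus the first time at which a random walk with positive mean step `μ` rises above a
barrier `a` or falls below a barrier `-b`, where `a` and `b` are the distances of the thresholds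
from `λ_0` (`sampleSize_eq_exitTime_zero`, `sampleSize_eq_exitTime_one`). For such a walk, the
expected exit time is asymptotic to `a / μ` as `a` and `b` tend to infinity independently of each
other (`tendsto_lintegral_exitTime_div`):

* Upper bound (`lintegral_exitTime_le`). Truncating the steps from above at `M` only delays the
  passage above `a`, and bounds the overshoot by `M`. Wald's identity then bounds the expected time
  by `(a + M) / μ_M`, where `μ_M` is the mean of the truncated step, and `μ_M → μ` as `M → ∞`. Only
  the first moment of the steps is used.
* Lower bound (`exists_le_lintegral_exitTime`). By the strong law of large numbers, with
  probability close to one the whole path lies between `-K` and a line of slope slightly above `μ`.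
  On that event a barrier `b ≥ K` is never crossed, and reaching `a` takes nearly `a / μ` steps.

The numerators of the claimed approximations differ from the barrier `a` by the product of an error
probability with the difference of the thresholds. As `α₀ ≤ exp (-η₁)` and `α₁ ≤ exp η₀`, this is
negligible against `a` (`tendsto_div_of_error_le`).
-/

namespace SwitchingSPRT

/-! ### First exit of a random walk from an interval -/

/-- The first `N ≥ 1` at which the partial sum `x 0 + ⋯ + x (N - 1)` lies above `a` or
below `-b`, and `⊤` if there is none. -/
noncomputable def exitTime (x : ℕ → ℝ) (a b : ℝ) : ℕ∞ :=
  ⨅ (N : ℕ) (_ : 1 ≤ N ∧ (a < ∑ i ∈ Finset.range N, x i ∨ ∑ i ∈ Finset.range N, x i < -b)),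
    (N : ℕ∞)

lemma exitTime_le {x : ℕ → ℝ} {a b : ℝ} {N : ℕ} (hN : 1 ≤ N)
    (h : a < ∑ i ∈ Finset.range N, x i) : exitTime x a b ≤ N :=
  iInf₂_le N ⟨hN, Or.inl h⟩

lemma le_exitTime {x : ℕ → ℝ} {a b : ℝ} {m : ℕ}
    (h : ∀ j < m, ∑ i ∈ Finset.range j, x i ≤ a ∧ -b ≤ ∑ i ∈ Finset.range j, x i) :
    (m : ℕ∞) ≤ exitTime x a b := by
  refine le_iInf₂ fun N hN => ?_
  by_contra hlt
  have hlt : N < m := by exact_mod_cast not_le.mp hlt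
  have := h N hlt
  rcases hN.2 with h' | h' <;> linarith

lemma toENNReal_le_tsum_indicator (N : ℕ∞) {p : ℕ → Prop} (h : ∀ i : ℕ, (i : ℕ∞) < N → p i) :
    (N : ℝ≥0∞) ≤ ∑' i, {i | p i}.indicator (fun _ => (1 : ℝ≥0∞)) i := by
  have key : ∀ m : ℕ, (m : ℕ∞) ≤ N →
      (m : ℝ≥0∞) ≤ ∑' i, {i | p i}.indicator (fun _ => (1 : ℝ≥0∞)) i := by
    intro m hm
    refine le_trans ?_ (ENNReal.sum_le_tsum (Finset.range m))
    rw [Finset.sum_congr rfl (g := fun _ => (1 : ℝ≥0∞))]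
    · simp
    · intro i hi
      have : (i : ℕ∞) < N := lt_of_lt_of_le (by exact_mod_cast Finset.mem_range.mp hi) hm
      exact Set.indicator_of_mem (show i ∈ {i | p i} from h i this) _
  induction N using ENat.recTopCoe with
  | top =>
    rw [ENat.toENNReal_top, ← ENNReal.iSup_natCast]
    exact iSup_le fun m => key m le_top
  | coe m => simpa using key m le_rfl

/-- If the steps are at most `M`, then the walk stopped at its first passage above `a` never
exceeds `a + M`. The sum over steps made before the passage is the stopped walk. -/
lemma sum_before_passage_le {x : ℕ → ℝ} {a M : ℝ} (ha : 0 ≤ a) (hM : 0 ≤ M)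
    (hx : ∀ i, x i ≤ M) (n : ℕ) :
    ∑ i ∈ Finset.range n,
      {i | ∀ j ≤ i, ∑ k ∈ Finset.range j, x k ≤ a}.indicator x i ≤ a + M := by
  set A : Set ℕ := {i | ∀ j ≤ i, ∑ k ∈ Finset.range j, x k ≤ a} with hA
  have main : ∀ n, (n ∈ A → ∑ i ∈ Finset.range n, A.indicator x i = ∑ i ∈ Finset.range n, x i)
      ∧ ∑ i ∈ Finset.range n, A.indicator x i ≤ a + M := by
    intro n
    induction n with
    | zero => simpa using by positivity
    | succ n ih =>
      rw [Finset.sum_range_succ, Finset.sum_range_succ]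
      have hsub : n + 1 ∈ A → n ∈ A := fun h j hj => h j (by omega)
      by_cases hn : n ∈ A
      · rw [Set.indicator_of_mem hn, ih.1 hn]
        exact ⟨fun _ => rfl, add_le_add (hn n le_rfl) (hx n)⟩
      · rw [Set.indicator_of_notMem hn, add_zero]
        exact ⟨fun h => absurd (hsub h) hn, ih.2⟩
  exact (main n).2

section Walk

variable {Ω : Type*} [MeasurableSpace Ω] {P : Measure Ω}

lemma measurableSet_before_passage {X : ℕ → Ω → ℝ} (hX : ∀ i, Measurable (X i)) (a : ℝ) (i : ℕ) :
    MeasurableSet {ω | ∀ j ≤ i, ∑ k ∈ Finset.range j, X k ω ≤ a} := by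
  have : {ω | ∀ j ≤ i, ∑ k ∈ Finset.range j, X k ω ≤ a}
      = ⋂ j, ⋂ (_ : j ≤ i), {ω | ∑ k ∈ Finset.range j, X k ω ≤ a} := by
    ext; simp
  rw [this]
  exact MeasurableSet.iInter fun j => MeasurableSet.iInter fun _ =>
    measurableSet_le (Finset.measurable_fun_sum _ fun k _ => hX k) measurable_const

/-- The `i`-th step is independent of the event that the first `i` steps have not led
above `a`. -/
lemma integral_indicator_before_passage {X : ℕ → Ω → ℝ} (hX : ∀ i, Measurable (X i))
    (hind : iIndepFun X P) (a : ℝ) (i : ℕ) :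
    ∫ ω, {ω | ∀ j ≤ i, ∑ k ∈ Finset.range j, X k ω ≤ a}.indicator (X i) ω ∂P
      = P.real {ω | ∀ j ≤ i, ∑ k ∈ Finset.range j, X k ω ≤ a} * ∫ ω, X i ω ∂P := by
  classical
  set A := {ω | ∀ j ≤ i, ∑ k ∈ Finset.range j, X k ω ≤ a} with hA
  have hAm : MeasurableSet A := measurableSet_before_passage hX a i
  -- extending a tuple by zero writes the event as a condition on the first `i` steps alone
  let ext : (Finset.range i → ℝ) → ℕ → ℝ := fun v k =>
    if h : k ∈ Finset.range i then v ⟨k, h⟩ else 0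
  have hext : ∀ k, Measurable fun v => ext v k := by
    intro k
    by_cases h : k ∈ Finset.range i
    · simp only [ext, h, dif_pos]; exact measurable_pi_apply _
    · simp only [ext, h, dif_neg, not_false_iff]; exact measurable_const
  let B : Set (Finset.range i → ℝ) := {v | ∀ j ≤ i, ∑ k ∈ Finset.range j, ext v k ≤ a}
  have hB : MeasurableSet B := measurableSet_before_passage hext a i
  have hAB : A = (fun ω (k : Finset.range i) => X k ω) ⁻¹' B := by
    ext ω
    refine forall₂_congr fun j hj => ?_
    rw [Finset.sum_congr rfl]
    intro k hk
    have : k ∈ Finset.range i := Finset.mem_range.mpr ((Finset.mem_range.mp hk).trans_le hj)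
    simp only [ext, this, dif_pos]
  have h1 := hind.indepFun_finset (Finset.range i) {i} (by simp) hX
  have h2 : IndepFun (fun ω => A.indicator (fun _ => (1 : ℝ)) ω) (X i) P := by
    have hψ : Measurable fun v : ({i} : Finset ℕ) → ℝ => v ⟨i, Finset.mem_singleton_self i⟩ :=
      measurable_pi_apply _
    have hφ : Measurable (B.indicator fun _ => (1 : ℝ)) := measurable_const.indicator hB
    have := h1.comp hφ hψ
    rw [hAB]
    exact this
  have h3 := h2.integral_fun_mul_eq_mul_integral
    (measurable_const.indicator hAm).aestronglyMeasurable (hX i).aestronglyMeasurable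
  rw [integral_indicator_const _ hAm, smul_eq_mul, mul_one] at h3
  rw [← h3]
  congr 1
  ext ω
  by_cases h : ω ∈ A <;> simp [h]

variable [IsProbabilityMeasure P]

/-- Wald's identity for a walk with steps bounded above: the expected time of the first passage
above `a` is at most `(a + M) / μ`. -/
lemma tsum_measure_before_passage_le {X : ℕ → Ω → ℝ} (hX : ∀ i, Measurable (X i))
    (hind : iIndepFun X P) (hint : ∀ i, Integrable (X i) P) {a M μ : ℝ} (hμ : 0 < μ)
    (hmean : ∀ i, ∫ ω, X i ω ∂P = μ) (ha : 0 ≤ a) (hM : 0 ≤ M) (hXM : ∀ i ω, X i ω ≤ M) :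
    ∑' i, P {ω | ∀ j ≤ i, ∑ k ∈ Finset.range j, X k ω ≤ a} ≤ ENNReal.ofReal ((a + M) / μ) := by
  refine ENNReal.tsum_le_of_sum_range_le fun n => ?_
  have hsum : ∑ i ∈ Finset.range n, P.real {ω | ∀ j ≤ i, ∑ k ∈ Finset.range j, X k ω ≤ a} * μ
      ≤ a + M := by
    have hI : ∀ i ∈ Finset.range n, Integrable
        (fun ω => {ω | ∀ j ≤ i, ∑ k ∈ Finset.range j, X k ω ≤ a}.indicator (X i) ω) P :=
      fun i _ => (hint i).indicator (measurableSet_before_passage hX a i)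
    calc _ = ∫ ω, ∑ i ∈ Finset.range n,
          {ω | ∀ j ≤ i, ∑ k ∈ Finset.range j, X k ω ≤ a}.indicator (X i) ω ∂P := by
          rw [integral_finsetSum _ hI]
          refine Finset.sum_congr rfl fun i _ => ?_
          rw [integral_indicator_before_passage hX hind, hmean]
      _ ≤ ∫ _, (a + M) ∂P :=
          integral_mono (integrable_finsetSum _ hI) (integrable_const _) fun ω =>
            sum_before_passage_le (x := fun i => X i ω) ha hM (fun i => hXM i ω) n
      _ = a + M := by simp
  rw [← Finset.sum_mul, ← le_div_iff₀ hμ] at hsum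
  calc _ = ENNReal.ofReal (∑ i ∈ Finset.range n,
        P.real {ω | ∀ j ≤ i, ∑ k ∈ Finset.range j, X k ω ≤ a}) := by
        rw [ENNReal.ofReal_sum_of_nonneg fun _ _ => measureReal_nonneg]
        exact Finset.sum_congr rfl fun i _ => (ofReal_measureReal (measure_ne_top _ _)).symm
    _ ≤ _ := ENNReal.ofReal_le_ofReal hsum

/-- Truncating the steps at `M` only delays the passage, so the truncated walk bounds the expected
exit time from above. -/
lemma lintegral_exitTime_le {X : ℕ → Ω → ℝ} (hX : ∀ i, Measurable (X i))
    (hind : iIndepFun X P) (hid : ∀ i, IdentDistrib (X i) (X 0) P P) (hint : Integrable (X 0) P)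
    {a b M : ℝ} (ha : 0 ≤ a) (hM : 0 ≤ M) (hμ : 0 < ∫ ω, min (X 0 ω) M ∂P) :
    ∫⁻ ω, (exitTime (fun i => X i ω) a b : ℝ≥0∞) ∂P
      ≤ ENNReal.ofReal ((a + M) / ∫ ω, min (X 0 ω) M ∂P) := by
  have hmin : Measurable fun t : ℝ => min t M := measurable_id.min measurable_const
  have hint' : Integrable (fun ω => min (X 0 ω) M) P := hint.inf (integrable_const M)
  have hid' : ∀ i, IdentDistrib (fun ω => min (X i ω) M) (fun ω => min (X 0 ω) M) P P :=
    fun i => (hid i).comp hmin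
  have hXm : ∀ i, Measurable fun ω => min (X i ω) M := fun i => hmin.comp (hX i)
  refine le_trans ?_ (tsum_measure_before_passage_le (X := fun i ω => min (X i ω) M) hXm
    (hind.comp (fun _ t => min t M) fun _ => hmin) (fun i => (hid' i).integrable_iff.mpr hint')
    hμ (fun i => (hid' i).integral_eq) ha hM fun i ω => min_le_right _ _)
  have hle : ∀ ω, (exitTime (fun i => X i ω) a b : ℝ≥0∞) ≤ ∑' i,
      {ω | ∀ j ≤ i, ∑ k ∈ Finset.range j, min (X k ω) M ≤ a}.indicator
        (fun _ => (1 : ℝ≥0∞)) ω := by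
    intro ω
    refine toENNReal_le_tsum_indicator
      (p := fun i => ∀ j ≤ i, ∑ k ∈ Finset.range j, min (X k ω) M ≤ a) _ fun i hi j hj => ?_
    by_contra! hlt
    have hj0 : 1 ≤ j := by
      rcases Nat.eq_zero_or_pos j with rfl | h
      · simp at hlt; linarith
      · exact h
    have hlt' : a < ∑ k ∈ Finset.range j, X k ω :=
      hlt.trans_le (Finset.sum_le_sum fun k _ => min_le_left _ _)
    exact absurd (hi.trans_le ((exitTime_le hj0 hlt').trans (by exact_mod_cast hj))) (lt_irrefl _)
  refine (lintegral_mono hle).trans ?_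
  have hAm := measurableSet_before_passage hXm a
  rw [lintegral_tsum fun i => (measurable_const.indicator (hAm i)).aemeasurable]
  refine ENNReal.tsum_le_tsum fun i => ?_
  rw [lintegral_indicator_const (hAm i), one_mul]

lemma tendsto_integral_min {X : Ω → ℝ} (hX : Integrable X P) :
    Tendsto (fun M : ℕ => ∫ ω, min (X ω) (M : ℝ) ∂P) atTop (𝓝 (∫ ω, X ω ∂P)) := by
  refine tendsto_integral_of_dominated_convergence (fun ω => |X ω|)
    (fun M => (hX.inf (integrable_const (M : ℝ))).aestronglyMeasurable) hX.abs
    (fun M => ae_of_all _ fun ω => ?_) (ae_of_all _ fun ω => ?_)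
  · have hM : (0 : ℝ) ≤ M := M.cast_nonneg
    rw [Real.norm_eq_abs, abs_le]
    exact ⟨le_min (neg_abs_le _) ((neg_nonpos.mpr (abs_nonneg _)).trans hM),
      (min_le_left _ _).trans (le_abs_self _)⟩
  · refine tendsto_const_nhds.congr' ?_
    filter_upwards [eventually_ge_atTop ⌈X ω⌉₊] with M hM
    exact (min_eq_left ((Nat.le_ceil _).trans (by exact_mod_cast hM))).symm

lemma exitTime_mono_left {x : ℕ → ℝ} {a a' b : ℝ} (h : a ≤ a') :
    exitTime x a b ≤ exitTime x a' b :=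
  le_iInf₂ fun N hN => iInf₂_le N ⟨hN.1, hN.2.imp_left h.trans_lt⟩

lemma lintegral_exitTime_lt_top {X : ℕ → Ω → ℝ} (hX : ∀ i, Measurable (X i))
    (hind : iIndepFun X P) (hid : ∀ i, IdentDistrib (X i) (X 0) P P) (hint : Integrable (X 0) P)
    (hμ : 0 < ∫ ω, X 0 ω ∂P) (a b : ℝ) :
    ∫⁻ ω, (exitTime (fun i => X i ω) a b : ℝ≥0∞) ∂P < ∞ := by
  obtain ⟨M, hM⟩ := ((tendsto_integral_min hint).eventually (lt_mem_nhds hμ)).exists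
  calc _ ≤ ∫⁻ ω, (exitTime (fun i => X i ω) (max a 0) b : ℝ≥0∞) ∂P :=
        lintegral_mono fun ω => ENat.toENNReal_mono (exitTime_mono_left (le_max_left _ _))
    _ ≤ _ := lintegral_exitTime_le hX hind hid hint (le_max_right _ _) M.cast_nonneg hM
    _ < ∞ := ENNReal.ofReal_lt_top

/-- By the strong law of large numbers, with probability close to one the whole path stays
between `-K` and a line of slope `r`, for any `r` above the mean. -/
lemma exists_measure_confined_ge {X : ℕ → Ω → ℝ}
    (hind : iIndepFun X P) (hid : ∀ i, IdentDistrib (X i) (X 0) P P) (hint : Integrable (X 0) P)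
    (hμ : 0 < ∫ ω, X 0 ω ∂P) {p r : ℝ} (hp : p < 1) (hr : ∫ ω, X 0 ω ∂P < r) :
    ∃ K : ℕ, ENNReal.ofReal p ≤ P {ω | ∀ j : ℕ, -(K : ℝ) ≤ ∑ i ∈ Finset.range j, X i ω ∧
      ∑ i ∈ Finset.range j, X i ω ≤ r * j + K} := by
  set E : ℕ → Set Ω := fun K => {ω | ∀ j : ℕ, -(K : ℝ) ≤ ∑ i ∈ Finset.range j, X i ω ∧
      ∑ i ∈ Finset.range j, X i ω ≤ r * j + K} with hE
  have hmono : Monotone E := by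
    intro K L hKL ω hω j
    have : (K : ℝ) ≤ L := by exact_mod_cast hKL
    exact ⟨by linarith [(hω j).1], by linarith [(hω j).2]⟩
  have hfull : P (⋃ K, E K) = 1 := by
    rw [← measure_univ (μ := P)]
    refine measure_congr (eventuallyEq_univ.mpr ?_)
    filter_upwards [strong_law_ae_real X hint (fun i j hij => hind.indepFun hij) hid] with ω hω
    have hev := (hω.eventually (lt_mem_nhds hμ)).and
      ((hω.eventually (gt_mem_nhds hr)).and (eventually_gt_atTop 0))
    obtain ⟨n, hn⟩ := eventually_atTop.mp hev
    -- beyond `n` the path is confined by the law of large numbers, before `n` by its finitely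
    -- many values
    obtain ⟨K, hK⟩ := exists_nat_gt
      (∑ j ∈ Finset.range n, (|∑ i ∈ Finset.range j, X i ω| + |r * j|))
    have hK0 : (0 : ℝ) ≤ K := K.cast_nonneg
    refine Set.mem_iUnion.mpr ⟨K, fun j => ?_⟩
    rcases lt_or_ge j n with hj | hj
    · have := (Finset.single_le_sum
        (f := fun j : ℕ => |∑ i ∈ Finset.range j, X i ω| + |r * (j : ℝ)|)
        (fun j _ => by positivity) (Finset.mem_range.mpr hj)).trans hK.le
      have h1 := neg_abs_le (∑ i ∈ Finset.range j, X i ω)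
      have h2 := le_abs_self (∑ i ∈ Finset.range j, X i ω)
      have h3 := neg_abs_le (r * (j : ℝ))
      have h4 := abs_nonneg (r * (j : ℝ))
      exact ⟨by linarith, by linarith⟩
    · obtain ⟨h1, h2, h3⟩ := hn j hj
      have hj0 : (0 : ℝ) < j := by exact_mod_cast h3
      rw [lt_div_iff₀ hj0, zero_mul] at h1
      rw [div_lt_iff₀ hj0] at h2
      exact ⟨by linarith, by linarith⟩
  have hlim := tendsto_measure_iUnion_atTop (μ := P) hmono
  rw [hfull] at hlim
  obtain ⟨K, hK⟩ := (hlim.eventually (lt_mem_nhds (ENNReal.ofReal_lt_one.mpr hp))).exists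
  exact ⟨K, hK.le⟩

/-- While the path stays below a line of slope `r`, it needs at least `(a - K) / r` steps to
reach `a`. -/
lemma exists_le_lintegral_exitTime {X : ℕ → Ω → ℝ} (hX : ∀ i, Measurable (X i))
    (hind : iIndepFun X P) (hid : ∀ i, IdentDistrib (X i) (X 0) P P) (hint : Integrable (X 0) P)
    (hμ : 0 < ∫ ω, X 0 ω ∂P) {p r : ℝ} (hp0 : 0 ≤ p) (hp : p < 1) (hr : ∫ ω, X 0 ω ∂P < r) :
    ∃ K : ℝ, ∀ a b, K ≤ b →
      ENNReal.ofReal (p * ((a - K) / r)) ≤ ∫⁻ ω, (exitTime (fun i => X i ω) a b : ℝ≥0∞) ∂P := by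
  obtain ⟨K, hK⟩ := exists_measure_confined_ge hind hid hint hμ hp hr
  refine ⟨K, fun a b hb => ?_⟩
  set E := {ω | ∀ j : ℕ, -(K : ℝ) ≤ ∑ i ∈ Finset.range j, X i ω ∧
      ∑ i ∈ Finset.range j, X i ω ≤ r * j + K} with hE
  have hr0 : 0 < r := hμ.trans hr
  have hEm : MeasurableSet E := by
    have : E = ⋂ j : ℕ, ({ω | -(K : ℝ) ≤ ∑ i ∈ Finset.range j, X i ω} ∩
        {ω | ∑ i ∈ Finset.range j, X i ω ≤ r * j + K}) := by
      ext; simp [hE]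
    rw [this]
    have hS : ∀ j : ℕ, Measurable fun ω => ∑ i ∈ Finset.range j, X i ω :=
      fun j => Finset.measurable_fun_sum _ fun k _ => hX k
    exact MeasurableSet.iInter fun j => (measurableSet_le measurable_const (hS j)).inter
      (measurableSet_le (hS j) measurable_const)
  set m := ⌈(a - K) / r⌉₊ with hm
  have hmul : ENNReal.ofReal (p * ((a - K) / r)) ≤ (m : ℝ≥0∞) * P E := by
    rw [ENNReal.ofReal_mul hp0, mul_comm]
    refine mul_le_mul' ?_ hK
    rw [← ENNReal.ofReal_natCast]
    exact ENNReal.ofReal_le_ofReal (Nat.le_ceil _)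
  refine hmul.trans ?_
  rw [← lintegral_indicator_const hEm]
  refine lintegral_mono fun ω => ?_
  by_cases hω : ω ∈ E
  · rw [Set.indicator_of_mem hω]
    have : (m : ℕ∞) ≤ exitTime (fun i => X i ω) a b := by
      refine le_exitTime fun j hj => ⟨?_, by linarith [(hω j).1]⟩
      have h1 := Nat.lt_ceil.mp hj
      rw [lt_div_iff₀ hr0] at h1
      linarith [(hω j).2]
    simpa using ENat.toENNReal_mono this
  · rw [Set.indicator_of_notMem hω]; exact zero_le

/-- The expected exit time of a walk with mean step `μ > 0` is asymptotic to `a / μ` as both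
barriers recede, at whatever relative speed. -/
theorem tendsto_lintegral_exitTime_div {X : ℕ → Ω → ℝ} (hX : ∀ i, Measurable (X i))
    (hind : iIndepFun X P) (hid : ∀ i, IdentDistrib (X i) (X 0) P P) (hint : Integrable (X 0) P)
    (hμ : 0 < ∫ ω, X 0 ω ∂P) :
    Tendsto (fun c : ℝ × ℝ =>
      (∫⁻ ω, (exitTime (fun i => X i ω) c.1 c.2 : ℝ≥0∞) ∂P).toReal / c.1)
      (atTop ×ˢ atTop) (𝓝 (∫ ω, X 0 ω ∂P)⁻¹) := by
  set μ := ∫ ω, X 0 ω ∂P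
  refine tendsto_order.mpr ⟨fun c hc => ?_, fun c hc => ?_⟩
  -- lower bound: probability `1 - t` and slope `μ + t`, with `t` so small that
  -- `(1 - t) / (μ + t)` still exceeds `c`
  · have hcont : Tendsto (fun t : ℝ => (1 - t) / (μ + t)) (𝓝[>] 0) (𝓝 μ⁻¹) := by
      have : ContinuousAt (fun t : ℝ => (1 - t) / (μ + t)) 0 := by
        refine ContinuousAt.div (by fun_prop) (by fun_prop) (by simpa using hμ.ne')
      have h := this.tendsto
      simp only [sub_zero, add_zero, one_div] at h
      exact h.mono_left nhdsWithin_le_nhds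
    obtain ⟨t, hct, ht⟩ := ((hcont.eventually (lt_mem_nhds hc)).and
      (Ioo_mem_nhdsGT (zero_lt_one (α := ℝ)))).exists
    obtain ⟨K, hK⟩ := exists_le_lintegral_exitTime hX hind hid hint hμ (p := 1 - t) (r := μ + t)
      (by linarith [ht.2]) (by linarith [ht.1]) (by linarith [ht.1])
    have hlim : Tendsto (fun a : ℝ => (1 - t) / (μ + t) * (1 - K / a)) atTop
        (𝓝 ((1 - t) / (μ + t) * (1 - 0))) :=
      (tendsto_const_nhds.sub (tendsto_const_nhds.div_atTop tendsto_id)).const_mul _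
    rw [sub_zero, mul_one] at hlim
    have hev := (hlim.eventually (lt_mem_nhds hct)).and (eventually_gt_atTop 0)
    filter_upwards [hev.prod_mk (eventually_ge_atTop K)] with x hx
    obtain ⟨⟨h1, h2⟩, h3⟩ := hx
    refine h1.trans_le ?_
    rw [le_div_iff₀ h2]
    have h4 := (ENNReal.ofReal_le_iff_le_toReal
      (lintegral_exitTime_lt_top hX hind hid hint hμ x.1 x.2).ne).mp (hK x.1 x.2 h3)
    refine le_of_eq_of_le ?_ h4
    have := h2.ne'
    field_simp
  -- upper bound: truncation at an `M` so large that the inverse of the truncated mean is below `c`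
  · have hinv := (tendsto_integral_min hint).inv₀ hμ.ne'
    obtain ⟨M, hMc, hM⟩ := ((hinv.eventually (gt_mem_nhds hc)).and
      ((tendsto_integral_min hint).eventually (lt_mem_nhds hμ))).exists
    set ρ := ∫ ω, min (X 0 ω) (M : ℝ) ∂P
    have hlim : Tendsto (fun a : ℝ => ρ⁻¹ * (1 + M / a)) atTop (𝓝 (ρ⁻¹ * (1 + 0))) :=
      (tendsto_const_nhds.add (tendsto_const_nhds.div_atTop tendsto_id)).const_mul _
    rw [add_zero, mul_one] at hlim
    have hev := (hlim.eventually (gt_mem_nhds hMc)).and (eventually_gt_atTop 0)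
    filter_upwards [hev.prod_inl (atTop : Filter ℝ)] with x hx
    obtain ⟨h1, h2⟩ := hx
    refine lt_of_le_of_lt ?_ h1
    rw [div_le_iff₀ h2]
    have hbound := ENNReal.toReal_le_of_le_ofReal
      (div_nonneg (add_nonneg h2.le M.cast_nonneg) hM.le)
      (lintegral_exitTime_le (b := x.2) hX hind hid hint h2.le M.cast_nonneg hM)
    refine hbound.trans_eq ?_
    have := h2.ne'
    have := hM.ne'
    field_simp

end Walk

/-! ### Positivity of the Kullback-Leibler distance -/

section Divergence

variable {Y : Type*} [MeasurableSpace Y] {ν : Measure Y}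

lemma IsDensity.integrable {f : Y → ℝ} (hf : IsDensity ν f) : Integrable f ν := by
  refine ⟨hf.measurable.aestronglyMeasurable, ?_⟩
  rw [hasFiniteIntegral_iff_ofReal (ae_of_all _ hf.nonneg), hf.lintegral_eq_one]
  exact ENNReal.one_lt_top

lemma IsDensity.integral_eq_one {f : Y → ℝ} (hf : IsDensity ν f) : ∫ y, f y ∂ν = 1 := by
  rw [integral_eq_lintegral_of_nonneg_ae (ae_of_all _ hf.nonneg)
    hf.measurable.aestronglyMeasurable, hf.lintegral_eq_one, ENNReal.toReal_one]

/-- The pointwise inequality behind Gibbs' inequality, in the form `x log (x / y) ≥ x - y`. -/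
lemma sub_le_mul_log_div {x y : ℝ} (hx : 0 ≤ x) (hy : 0 ≤ y) (h : y = 0 → x = 0) :
    x - y ≤ x * Real.log (x / y) := by
  rcases hx.eq_or_lt with rfl | hx'
  · simpa using hy
  have hy' : 0 < y := hy.lt_of_ne fun h0 => hx'.ne' (h h0.symm)
  have h1 := Real.one_sub_inv_le_log_of_pos (div_pos hx' hy')
  have h2 := mul_le_mul_of_nonneg_left h1 hx
  rw [inv_div, mul_sub, mul_div_cancel₀ _ hx'.ne', mul_one] at h2
  exact h2

lemma eq_of_mul_log_div_eq_sub {x y : ℝ} (hx : 0 ≤ x) (hy : 0 ≤ y) (h : y = 0 → x = 0)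
    (he : x * Real.log (x / y) = x - y) : x = y := by
  rcases hx.eq_or_lt with rfl | hx'
  · simpa [eq_comm] using he
  have hy' : 0 < y := hy.lt_of_ne fun h0 => hx'.ne' (h h0.symm)
  by_contra hne
  have hr : y / x ≠ 1 := fun h1 => hne ((div_eq_one_iff_eq hx'.ne').mp h1).symm
  have h1 := mul_lt_mul_of_pos_left (Real.log_lt_sub_one_of_pos (div_pos hy' hx') hr) hx'
  rw [← inv_div x y, Real.log_inv, inv_div, mul_sub, mul_div_cancel₀ _ hx'.ne'] at h1
  linarith

/-- Since two densities have the same integral, subtracting `f - g` makes the integrand nonnegative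
without changing its integral. -/
lemma klDist_eq_integral_sub {f g : Y → ℝ} (hf : IsDensity ν f) (hg : IsDensity ν g)
    (h : KLFinite ν f g) :
    klDist ν f g = ∫ y, (f y * Real.log (f y / g y) - (f y - g y)) ∂ν := by
  have hfg : Integrable (fun y => f y - g y) ν := hf.integrable.sub hg.integrable
  rw [integral_sub h.2 hfg, integral_sub hf.integrable hg.integrable, hf.integral_eq_one,
    hg.integral_eq_one, sub_self, sub_zero, klDist]

lemma ae_nonneg_mul_log_div_sub {f g : Y → ℝ} (hf : IsDensity ν f) (hg : IsDensity ν g)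
    (h : KLFinite ν f g) : 0 ≤ᵐ[ν] fun y => f y * Real.log (f y / g y) - (f y - g y) := by
  filter_upwards [h.1] with y hy
  exact sub_nonneg.mpr (sub_le_mul_log_div (hf.nonneg y) (hg.nonneg y) hy)

lemma klDist_nonneg {f g : Y → ℝ} (hf : IsDensity ν f) (hg : IsDensity ν g)
    (h : KLFinite ν f g) : 0 ≤ klDist ν f g := by
  rw [klDist_eq_integral_sub hf hg h]
  exact integral_nonneg_of_ae (ae_nonneg_mul_log_div_sub hf hg h)

lemma klDist_pos {f g : Y → ℝ} (hf : IsDensity ν f) (hg : IsDensity ν g)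
    (h : KLFinite ν f g) (hne : ¬ f =ᵐ[ν] g) : 0 < klDist ν f g := by
  refine (klDist_nonneg hf hg h).lt_of_ne fun h0 => hne ?_
  rw [klDist_eq_integral_sub hf hg h] at h0
  have h1 := (integral_eq_zero_iff_of_nonneg_ae (ae_nonneg_mul_log_div_sub hf hg h)
    (h.2.sub (hf.integrable.sub hg.integrable))).mp h0.symm
  filter_upwards [h1, h.1] with y hy hy'
  exact eq_of_mul_log_div_eq_sub (hf.nonneg y) (hg.nonneg y) hy' (sub_eq_zero.mp hy)

end Divergence

/-! ### The law of one observation -/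

section Law

variable {n : ℕ} {Y : Type*} [MeasurableSpace Y]

/-- The law of a pair (sensor, value): sensor `j` has probability `q j`, and its value has
density `f j` with respect to `ν`. -/
noncomputable def observationLaw (ν : Measure Y) (q : Fin n → ℝ) (f : Fin n → Y → ℝ) :
    Measure (Fin n × Y) :=
  ∑ j, ENNReal.ofReal (q j) • (ν.withDensity fun y => ENNReal.ofReal (f j y)).map (Prod.mk j)

variable {ν : Measure Y} {q : Fin n → ℝ} {f : Fin n → Y → ℝ}

lemma integrable_withDensity_ofReal {f g : Y → ℝ} (hf : IsDensity ν f) :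
    Integrable g (ν.withDensity fun y => ENNReal.ofReal (f y)) ↔
      Integrable (fun y => f y * g y) ν := by
  rw [integrable_withDensity_iff hf.measurable.ennreal_ofReal
    (ae_of_all _ fun _ => ENNReal.ofReal_lt_top)]
  simp only [ENNReal.toReal_ofReal (hf.nonneg _), mul_comm]

lemma integral_withDensity_ofReal {f g : Y → ℝ} (hf : IsDensity ν f) :
    ∫ y, g y ∂(ν.withDensity fun y => ENNReal.ofReal (f y)) = ∫ y, f y * g y ∂ν := by
  rw [integral_withDensity_eq_integral_toReal_smul hf.measurable.ennreal_ofReal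
    (ae_of_all _ fun _ => ENNReal.ofReal_lt_top)]
  simp only [ENNReal.toReal_ofReal (hf.nonneg _), smul_eq_mul]

lemma integrable_smul_map_mk (hf : ∀ j, IsDensity ν (f j)) {g : Fin n × Y → ℝ}
    (hg : Measurable g) (hint : ∀ j, Integrable (fun y => f j y * g (j, y)) ν) (j : Fin n) :
    Integrable g (ENNReal.ofReal (q j) •
      (ν.withDensity fun y => ENNReal.ofReal (f j y)).map (Prod.mk j)) := by
  refine Integrable.smul_measure ?_ ENNReal.ofReal_ne_top
  rw [integrable_map_measure hg.aestronglyMeasurable measurable_prodMk_left.aemeasurable]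
  exact (integrable_withDensity_ofReal (hf j)).mpr (hint j)

lemma integrable_observationLaw (hf : ∀ j, IsDensity ν (f j)) {g : Fin n × Y → ℝ}
    (hg : Measurable g) (hint : ∀ j, Integrable (fun y => f j y * g (j, y)) ν) :
    Integrable g (observationLaw ν q f) :=
  integrable_finsetSum_measure.mpr fun j _ => integrable_smul_map_mk hf hg hint j

lemma integral_observationLaw (hq : ∀ j, 0 ≤ q j) (hf : ∀ j, IsDensity ν (f j))
    {g : Fin n × Y → ℝ} (hg : Measurable g)
    (hint : ∀ j, Integrable (fun y => f j y * g (j, y)) ν) :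
    ∫ z, g z ∂observationLaw ν q f = ∑ j, q j * ∫ y, f j y * g (j, y) ∂ν := by
  rw [observationLaw, integral_finsetSum_measure fun j _ => integrable_smul_map_mk hf hg hint j]
  refine Finset.sum_congr rfl fun j _ => ?_
  rw [integral_smul_measure, integral_map measurable_prodMk_left.aemeasurable
    hg.aestronglyMeasurable, integral_withDensity_ofReal (hf j), ENNReal.toReal_ofReal (hq j),
    smul_eq_mul]

lemma map_eq_observationLaw {Ω : Type*} [MeasurableSpace Ω] {P : Measure Ω} {s : Ω → Fin n}
    {y : Ω → Y} (hs : Measurable s) (hy : Measurable y)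
    (hlaw : ∀ j (B : Set Y), MeasurableSet B → P (s ⁻¹' {j} ∩ y ⁻¹' B)
      = ENNReal.ofReal (q j) * ∫⁻ x in B, ENNReal.ofReal (f j x) ∂ν) :
    P.map (fun ω => (s ω, y ω)) = observationLaw ν q f := by
  ext B hB
  rw [Measure.map_apply (hs.prodMk hy) hB, observationLaw, Measure.finsetSum_apply]
  have hpart : (fun ω => (s ω, y ω)) ⁻¹' B = ⋃ j, s ⁻¹' {j} ∩ y ⁻¹' (Prod.mk j ⁻¹' B) := by
    ext ω; simp
  rw [hpart, measure_iUnion, tsum_fintype]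
  · refine Finset.sum_congr rfl fun j _ => ?_
    have hBj : MeasurableSet (Prod.mk j ⁻¹' B) := measurable_prodMk_left hB
    rw [hlaw j _ hBj, Measure.smul_apply, Measure.map_apply measurable_prodMk_left hB,
      withDensity_apply _ hBj, smul_eq_mul]
  · intro i j hij
    refine Set.disjoint_left.mpr fun ω hi hj => hij ?_
    exact hi.1.symm.trans hj.1
  · exact fun j => (hs (measurableSet_singleton j)).inter (hy (measurable_prodMk_left hB))

end Law

/-! ### The log likelihood ratios as steps of a random walk -/

section Model

variable {n : ℕ} {Y : Type*} [MeasurableSpace Y] {ν : Measure Y}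
  {Ω : Type*} [MeasurableSpace Ω] {P : Measure Ω}
  {π : Fin 2 → ℝ} {q : Fin n → ℝ} {f : Fin 2 → Fin n → Y → ℝ}
  {H : Ω → Fin 2} {s : ℕ → Ω → Fin n} {y : ℕ → Ω → Y}

/-- The log likelihood ratio of hypothesis `k` against hypothesis `k'` given by one observation,
consisting of a sensor and a value. -/
noncomputable def logRatio (f : Fin 2 → Fin n → Y → ℝ) (k k' : Fin 2) (z : Fin n × Y) : ℝ :=
  Real.log (f k z.1 z.2 / f k' z.1 z.2)

lemma measurable_logRatio (hf : ∀ k j, IsDensity ν (f k j)) (k k' : Fin 2) :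
    Measurable (logRatio f k k') :=
  measurable_from_prod_countable_right fun j =>
    ((hf k j).measurable.div (hf k' j).measurable).log

lemma IsModel.isProbabilityMeasure_cond [IsProbabilityMeasure P] (hπ : ∀ k, 0 < π k)
    (hmodel : IsModel ν P π q f H s y) (k : Fin 2) :
    IsProbabilityMeasure (P[|H ⁻¹' {k}]) := by
  refine cond_isProbabilityMeasure ?_
  rw [hmodel.prior k]
  exact (ENNReal.ofReal_pos.mpr (hπ k)).ne'

/-- Given `H = k`, the ratios in favour of `k` are the steps of a random walk whose mean step is
the average Kullback-Leibler distance. -/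
lemma IsModel.walk_logRatio (hq : ∀ j, 0 ≤ q j) (hf : ∀ k j, IsDensity ν (f k j))
    (hmodel : IsModel ν P π q f H s y) {k k' : Fin 2}
    (hD : ∀ j, KLFinite ν (f k j) (f k' j)) :
    (∀ l, Measurable fun ω => logRatio f k k' (s l ω, y l ω)) ∧
    iIndepFun (fun l ω => logRatio f k k' (s l ω, y l ω)) (P[|H ⁻¹' {k}]) ∧
    (∀ l, IdentDistrib (fun ω => logRatio f k k' (s l ω, y l ω))
      (fun ω => logRatio f k k' (s 0 ω, y 0 ω)) (P[|H ⁻¹' {k}]) (P[|H ⁻¹' {k}])) ∧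
    Integrable (fun ω => logRatio f k k' (s 0 ω, y 0 ω)) (P[|H ⁻¹' {k}]) ∧
    ∫ ω, logRatio f k k' (s 0 ω, y 0 ω) ∂(P[|H ⁻¹' {k}])
      = ∑ j, q j * klDist ν (f k j) (f k' j) := by
  have hg := measurable_logRatio hf k k'
  have hz : ∀ l, Measurable fun ω => (s l ω, y l ω) := fun l =>
    (hmodel.measurable_sensor l).prodMk (hmodel.measurable_value l)
  have hmap : ∀ l, (P[|H ⁻¹' {k}]).map (fun ω => (s l ω, y l ω)) = observationLaw ν q (f k) :=
    fun l => map_eq_observationLaw (hmodel.measurable_sensor l) (hmodel.measurable_value l)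
      (hmodel.law k l)
  refine ⟨fun l => hg.comp (hz l), (hmodel.indep k).comp (fun _ => logRatio f k k') fun _ => hg,
    fun l => IdentDistrib.comp (u := logRatio f k k')
      ⟨(hz l).aemeasurable, (hz 0).aemeasurable, by rw [hmap, hmap]⟩ hg, ?_, ?_⟩
  · have h := integrable_observationLaw (q := q) (hf k) hg fun j => (hD j).2
    rw [← hmap 0] at h
    exact h.comp_measurable (hz 0)
  · rw [← integral_map (φ := fun ω => (s 0 ω, y 0 ω)) (hz 0).aemeasurable hg.aestronglyMeasurable,
      hmap 0, integral_observationLaw hq (hf k) hg fun j => (hD j).2]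
    rfl

lemma sum_mul_klDist_pos (hq : ∀ j, 0 ≤ q j) (hf : ∀ k j, IsDensity ν (f k j)) {k k' : Fin 2}
    (hD : ∀ j, KLFinite ν (f k j) (f k' j))
    (hne : ∃ j, 0 < q j ∧ ¬ f k j =ᵐ[ν] f k' j) :
    0 < ∑ j, q j * klDist ν (f k j) (f k' j) := by
  obtain ⟨j, hj, hj'⟩ := hne
  exact Finset.sum_pos' (fun i _ => mul_nonneg (hq i) (klDist_nonneg (hf k i) (hf k' i) (hD i)))
    ⟨j, Finset.mem_univ j, mul_pos hj (klDist_pos (hf k j) (hf k' j) (hD j) hj')⟩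

end Model

lemma logRatio_swap {n : ℕ} {Y : Type*} (f : Fin 2 → Fin n → Y → ℝ) (k k' : Fin 2)
    (z : Fin n × Y) :
    logRatio f k k' z = -logRatio f k' k z := by
  rw [logRatio, logRatio, ← Real.log_inv, inv_div]

lemma sampleSize_eq_exitTime_one {n : ℕ} {Y Ω : Type*} (π : Fin 2 → ℝ)
    (f : Fin 2 → Fin n → Y → ℝ) (s : ℕ → Ω → Fin n) (y : ℕ → Ω → Y) (η₀ η₁ : ℝ) (ω : Ω) :
    sampleSize π f s y η₀ η₁ ω = exitTime (fun l => logRatio f 1 0 (s l ω, y l ω))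
      (η₁ - Real.log (π 1 / π 0)) (Real.log (π 1 / π 0) - η₀) := by
  unfold sampleSize exitTime evidence
  refine iInf_congr fun N => iInf_congr_Prop (and_congr_right fun _ => ?_) fun _ => rfl
  rw [sub_lt_iff_lt_add', neg_sub, lt_sub_iff_add_lt']
  rfl

/-- Under `H = 0` the walk is the negative of the evidence, so the two barriers trade places. -/
lemma sampleSize_eq_exitTime_zero {n : ℕ} {Y Ω : Type*} (π : Fin 2 → ℝ)
    (f : Fin 2 → Fin n → Y → ℝ) (s : ℕ → Ω → Fin n) (y : ℕ → Ω → Y) (η₀ η₁ : ℝ) (ω : Ω) :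
    sampleSize π f s y η₀ η₁ ω = exitTime (fun l => logRatio f 0 1 (s l ω, y l ω))
      (Real.log (π 1 / π 0) - η₀) (η₁ - Real.log (π 1 / π 0)) := by
  rw [sampleSize_eq_exitTime_one]
  unfold exitTime
  refine iInf_congr fun N => iInf_congr_Prop (and_congr_right fun _ => ?_) fun _ => rfl
  simp only [logRatio_swap f 1 0, Finset.sum_neg_distrib]
  rw [or_comm, neg_lt_neg_iff, lt_neg]

/-! ### Large thresholds -/

lemma tendsto_neg_eta0 : Tendsto (fun α => -eta0 α) largeThresholds atTop :=
  (tendsto_fst.comp tendsto_comap).mono_left inf_le_left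

lemma tendsto_eta1 : Tendsto eta1 largeThresholds atTop :=
  (tendsto_snd.comp tendsto_comap).mono_left inf_le_left

lemma eventually_mem_errorPairs : ∀ᶠ α in largeThresholds, α ∈ errorPairs :=
  mem_inf_of_right (mem_principal_self _)

lemma fst_le_exp_neg_eta1 {α : ℝ × ℝ} (h : α ∈ errorPairs) : α.1 ≤ Real.exp (-eta1 α) := by
  obtain ⟨⟨h1, h2⟩, h3, h4⟩ := h
  rw [eta1, ← Real.log_inv, inv_div, Real.exp_log (div_pos h1 (by linarith)),
    le_div_iff₀ (by linarith)]
  nlinarith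

lemma snd_le_exp_eta0 {α : ℝ × ℝ} (h : α ∈ errorPairs) : α.2 ≤ Real.exp (-(-eta0 α)) := by
  obtain ⟨⟨h1, h2⟩, h3, h4⟩ := h
  rw [neg_neg, eta0, Real.exp_log (div_pos h3 (by linarith)), le_div_iff₀ (by linarith)]
  nlinarith

/-- If an error probability `u` is at most `exp (-v)` with `v → ∞`, then it is negligible even
against `v` itself. -/
lemma tendsto_of_le_exp_neg {ι : Type*} {l : Filter ι} {u v : ι → ℝ} (hv : Tendsto v l atTop)
    (hu : ∀ᶠ i in l, 0 ≤ u i) (huv : ∀ᶠ i in l, u i ≤ Real.exp (-v i)) :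
    Tendsto u l (𝓝 0) ∧ Tendsto (fun i => u i * v i) l (𝓝 0) := by
  constructor
  · exact squeeze_zero' hu huv (Real.tendsto_exp_neg_atTop_nhds_zero.comp hv)
  · have h := (Real.tendsto_pow_mul_exp_neg_atTop_nhds_zero 1).comp hv
    refine squeeze_zero' ?_ ?_ h
    · filter_upwards [hu, hv.eventually_ge_atTop 0] with i h1 h2 using mul_nonneg h1 h2
    · filter_upwards [huv, hv.eventually_ge_atTop 0] with i h1 h2
      simpa [mul_comm] using mul_le_mul_of_nonneg_right h1 h2

/-- With `x` and `v` the distances of the two thresholds from zero and `u` the small error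
probability, the numerator `(1 - u) x - u v + c` is asymptotic to the barrier `x + c`. -/
lemma tendsto_div_of_error_le {ι : Type*} {l : Filter ι} {u v x E : ι → ℝ} {c D : ℝ}
    (hD : 0 < D) (hx : Tendsto x l atTop) (hv : Tendsto v l atTop) (hu : ∀ᶠ i in l, 0 ≤ u i)
    (huv : ∀ᶠ i in l, u i ≤ Real.exp (-v i))
    (hE : Tendsto (fun i => E i / (x i + c)) l (𝓝 D⁻¹)) :
    Tendsto (fun i => E i / (((1 - u i) * x i - u i * v i + c) / D)) l (𝓝 1) := by
  obtain ⟨h1, h2⟩ := tendsto_of_le_exp_neg hv hu huv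
  have ha : Tendsto (fun i => x i + c) l atTop := tendsto_atTop_add_const_right _ _ hx
  have hR : Tendsto (fun i => 1 - u i + (u i * c - u i * v i) / (x i + c)) l
      (𝓝 (1 - 0 + 0)) :=
    (tendsto_const_nhds.sub h1).add (((h1.mul_const c).sub h2).div_atTop ha)
  have hlim := (hE.mul_const D).div hR (by norm_num)
  rw [inv_mul_cancel₀ hD.ne', sub_zero, add_zero, div_one] at hlim
  refine hlim.congr' ?_
  filter_upwards [ha.eventually_gt_atTop 0] with i hi
  have hne := hi.ne'
  have hV : (1 - u i) * x i - u i * v i + c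
      = (1 - u i + (u i * c - u i * v i) / (x i + c)) * (x i + c) := by
    field_simp
    ring
  rw [hV, Pi.div_apply, div_div_eq_mul_div, div_mul_eq_mul_div, div_div, mul_comm (x i + c)]

end SwitchingSPRT

/-! ### The expected sample size -/

theorem mainTheorem6 {n : ℕ} {Y : Type*} [MeasurableSpace Y] (ν : Measure Y)
    {Ω : Type*} [MeasurableSpace Ω] (P : Measure Ω) [IsProbabilityMeasure P]
    (π : Fin 2 → ℝ) (q : Fin n → ℝ) (f : Fin 2 → Fin n → Y → ℝ)
    (H : Ω → Fin 2) (s : ℕ → Ω → Fin n) (y : ℕ → Ω → Y)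
    (hπ : ∀ k, 0 < π k)
    (hq : ∀ j, 0 ≤ q j) (hq_sum : ∑ j, q j = 1)
    (hf : ∀ k j, SwitchingSPRT.IsDensity ν (f k j))
    (hD : ∀ j, SwitchingSPRT.KLFinite ν (f 0 j) (f 1 j) ∧
      SwitchingSPRT.KLFinite ν (f 1 j) (f 0 j))
    (hne : ∃ j, 0 < q j ∧ ¬ f 0 j =ᵐ[ν] f 1 j)
    (hmodel : SwitchingSPRT.IsModel ν P π q f H s y) :
    (∀ k, ∀ α ∈ SwitchingSPRT.errorPairs,
      SwitchingSPRT.condExpSize P (H ⁻¹' {k}) (SwitchingSPRT.sampleSize π f s y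
        (SwitchingSPRT.eta0 α) (SwitchingSPRT.eta1 α)) < ∞) ∧
    Tendsto (fun α : ℝ × ℝ =>
      (SwitchingSPRT.condExpSize P (H ⁻¹' {0}) (SwitchingSPRT.sampleSize π f s y
        (SwitchingSPRT.eta0 α) (SwitchingSPRT.eta1 α))).toReal /
      (-((1 - α.1) * SwitchingSPRT.eta0 α + α.1 * SwitchingSPRT.eta1 α
          - Real.log (π 1 / π 0)) /
        ∑ j, q j * SwitchingSPRT.klDist ν (f 0 j) (f 1 j)))
      SwitchingSPRT.largeThresholds (𝓝 1) ∧
    Tendsto (fun α : ℝ × ℝ =>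
      (SwitchingSPRT.condExpSize P (H ⁻¹' {1}) (SwitchingSPRT.sampleSize π f s y
        (SwitchingSPRT.eta0 α) (SwitchingSPRT.eta1 α))).toReal /
      ((α.2 * SwitchingSPRT.eta0 α + (1 - α.2) * SwitchingSPRT.eta1 α
          - Real.log (π 1 / π 0)) /
        ∑ j, q j * SwitchingSPRT.klDist ν (f 1 j) (f 0 j)))
      SwitchingSPRT.largeThresholds (𝓝 1) := by 
  have hD01 := fun j => (hD j).1
  have hD10 := fun j => (hD j).2
  have hne' : ∃ j, 0 < q j ∧ ¬ f 1 j =ᵐ[ν] f 0 j :=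
    hne.imp fun j hj => ⟨hj.1, fun h => hj.2 h.symm⟩
  have pos0 := SwitchingSPRT.sum_mul_klDist_pos hq hf hD01 hne
  have pos1 := SwitchingSPRT.sum_mul_klDist_pos hq hf hD10 hne'
  have := hmodel.isProbabilityMeasure_cond hπ
  obtain ⟨hX0, hind0, hid0, hint0, hmean0⟩ := hmodel.walk_logRatio hq hf hD01
  obtain ⟨hX1, hind1, hid1, hint1, hmean1⟩ := hmodel.walk_logRatio hq hf hD10
  have hη0 := SwitchingSPRT.tendsto_neg_eta0
  have hη1 := SwitchingSPRT.tendsto_eta1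
  have hmem := SwitchingSPRT.eventually_mem_errorPairs
  have hb0 : Tendsto (fun α => Real.log (π 1 / π 0) - SwitchingSPRT.eta0 α)
      SwitchingSPRT.largeThresholds atTop := tendsto_atTop_add_const_left _ _ hη0
  have hb1 : Tendsto (fun α => SwitchingSPRT.eta1 α - Real.log (π 1 / π 0))
      SwitchingSPRT.largeThresholds atTop := tendsto_atTop_add_const_right _ _ hη1
  refine ⟨fun k α _ => ?_, ?_, ?_⟩
  · unfold SwitchingSPRT.condExpSize
    fin_cases k
    · simp only [SwitchingSPRT.sampleSize_eq_exitTime_zero]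
      exact SwitchingSPRT.lintegral_exitTime_lt_top hX0 hind0 hid0 hint0 (hmean0 ▸ pos0) _ _
    · simp only [SwitchingSPRT.sampleSize_eq_exitTime_one]
      exact SwitchingSPRT.lintegral_exitTime_lt_top hX1 hind1 hid1 hint1 (hmean1 ▸ pos1) _ _
  · have h := (SwitchingSPRT.tendsto_lintegral_exitTime_div hX0 hind0 hid0 hint0
      (hmean0 ▸ pos0)).comp (hb0.prodMk hb1)
    rw [hmean0] at h
    refine (SwitchingSPRT.tendsto_div_of_error_le (x := fun α => -SwitchingSPRT.eta0 α)
      (E := fun α => (SwitchingSPRT.condExpSize P (H ⁻¹' {0}) (SwitchingSPRT.sampleSize π f s y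
        (SwitchingSPRT.eta0 α) (SwitchingSPRT.eta1 α))).toReal)
      (c := Real.log (π 1 / π 0)) pos0 hη0 hη1 (hmem.mono fun α hα => hα.1.1.le)
      (hmem.mono fun α hα => SwitchingSPRT.fst_le_exp_neg_eta1 hα)
      (h.congr fun α => ?_)).congr fun α => ?_
    · simp only [SwitchingSPRT.condExpSize, SwitchingSPRT.sampleSize_eq_exitTime_zero,
        ← sub_eq_neg_add, Function.comp_apply]
    · congr 2
      ring
  · have h := (SwitchingSPRT.tendsto_lintegral_exitTime_div hX1 hind1 hid1 hint1
      (hmean1 ▸ pos1)).comp (hb1.prodMk hb0)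
    rw [hmean1] at h
    refine (SwitchingSPRT.tendsto_div_of_error_le (v := fun α => -SwitchingSPRT.eta0 α)
      (E := fun α => (SwitchingSPRT.condExpSize P (H ⁻¹' {1}) (SwitchingSPRT.sampleSize π f s y
        (SwitchingSPRT.eta0 α) (SwitchingSPRT.eta1 α))).toReal)
      (c := -Real.log (π 1 / π 0)) pos1 hη1 hη0 (hmem.mono fun α hα => hα.2.1.le)
      (hmem.mono fun α hα => SwitchingSPRT.snd_le_exp_eta0 hα)
      (h.congr fun α => ?_)).congr fun α => ?_
    · simp only [SwitchingSPRT.condExpSize, SwitchingSPRT.sampleSize_eq_exitTime_one,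
        ← sub_eq_add_neg, Function.comp_apply]
    · congr 2
      ring
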